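/- Let $G=(V,E)$ be a finite simple graph of order $n=|V|$ (not necessarily connected), where the vertex set $V$ is linearly ordered (for example $V=\{1,2,\ldots,n\}$). Let $P(G,x)$ be its chromatic polynomial, i.e. the polynomial whose value at every positive integer $k$ is the number of proper $k$-colorings of $G$, and for $1\le i\le n$ let $a_i(G)$ be $(-1)^{n-i}$ times the coefficient of $x^i$ in $P(G,x)$. For a graph $H$ and a vertex $w$ of $H$, let $\alpha(H,w)$ be the number of acyclic orientations of $H$ in which $w$ is the unique source (vertex of in-degree zero). For $v\in V$ and $1\le i\le n$, let $\mathcal{OP}_{i,v}(V)$ be the set of ordered partitions $(V_1,V_2,\ldots,V_i)$ of $V$ into non-empty parts such that (a) every induced subgraph $G[V_j]$, $1\le j\le i$, is connected, and $v\in V_1$; (b) for every $j=2,\ldots,i$, the least element of $\bigcup_{j\le s\le i}V_s$ belongs to $V_j$. Then for every $v\in V$ and every $1\le i\le n$, $$a_i(G)=\sum_{(V_1,\ldots,V_i)\in\mathcal{OP}_{i,v}(V)}\alpha(G[V_1],v)\prod_{j=2}^{i}\alpha(G[V_j],m_j),$$ where $m_j$ is the least vertex in $V_j$ for $j=2,\ldots,i$.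 -/

import Mathlib

open Polynomial

noncomputable section

namespace ChromaticCoeff

/-! ### The chromatic polynomial and the numbers `a_i(G)` -/

/-- The number of proper `k`-colorings of `G`. -/
def numColorings {V : Type*} (G : SimpleGraph V) (k : ℕ) : ℕ :=
  Nat.card (G.Coloring (Fin k))

open scoped Classical in
/-- There is an integer polynomial that counts the proper `k`-colorings of a finite graph,
so the chromatic polynomial below is well defined. -/
theorem exists_chromaticPolynomial {V : Type*} [Fintype V] (G : SimpleGraph V) :
    ∃ P : ℤ[X], ∀ k : ℕ, 1 ≤ k → P.eval (k : ℤ) = numColorings G k := by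
  refine ⟨∑ S ∈ G.edgeFinset.powerset, (-1) ^ S.card *
    X ^ Nat.card (SimpleGraph.fromEdgeSet (S : Set (Sym2 V))).ConnectedComponent, fun k _ => ?_⟩
  have hcount : ∀ S : Finset (Sym2 V), S ⊆ G.edgeFinset →
      ((k : ℤ) ^ Nat.card (SimpleGraph.fromEdgeSet (S : Set (Sym2 V))).ConnectedComponent) =
        ∑ f : V → Fin k, if ∀ e ∈ S, (e.map f).IsDiag then 1 else 0 := by
    intro S hS
    let H := SimpleGraph.fromEdgeSet (S : Set (Sym2 V))
    have e : (H.ConnectedComponent → Fin k) ≃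
        {f : V → Fin k // ∀ e ∈ S, (e.map f).IsDiag} :=
      { toFun := fun g => ⟨fun v => g (H.connectedComponentMk v), by
          intro e
          induction e with | _ u v
          intro he
          have hadj : H.Adj u v := by
            have h1 := hS he
            rw [SimpleGraph.mem_edgeFinset, SimpleGraph.mem_edgeSet] at h1
            exact (SimpleGraph.fromEdgeSet_adj _).2 ⟨he, h1.ne⟩
          simp only [Sym2.map_mk, Sym2.mk_isDiag_iff]
          exact congrArg g (SimpleGraph.ConnectedComponent.sound hadj.reachable)⟩
        invFun := fun f => SimpleGraph.ConnectedComponent.lift f.1 (by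
          intro v w p _
          induction p with
          | nil => rfl
          | cons h _ ih =>
            rename_i hp
            have h2 := f.2 _ ((SimpleGraph.fromEdgeSet_adj _).1 h).1
            simp only [Sym2.map_mk, Sym2.mk_isDiag_iff] at h2
            exact h2.trans (ih hp.of_cons))
        left_inv := by
          intro g
          funext c
          induction c using SimpleGraph.ConnectedComponent.ind
          rfl
        right_inv := by
          intro f
          rfl }
    have h3 := Nat.card_congr e
    rw [Nat.card_fun, Nat.card_fin, Nat.card_eq_fintype_card (α := Subtype _),
      Fintype.card_subtype] at h3
    rw [Finset.sum_boole, ← h3]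
    push_cast
    rfl
  have hprod : ∀ f : V → Fin k,
      (∑ S ∈ G.edgeFinset.powerset,
        (-1 : ℤ) ^ S.card * if ∀ e ∈ S, (e.map f).IsDiag then 1 else 0) =
      if ∀ u v, G.Adj u v → f u ≠ f v then 1 else 0 := by
    intro f
    have h4 := Finset.prod_add (fun e : Sym2 V => -(if (e.map f).IsDiag then (1 : ℤ) else 0))
      (fun _ => 1) G.edgeFinset
    have h5 : ∀ S : Finset (Sym2 V),
        (∏ e ∈ S, -(if (e.map f).IsDiag then (1 : ℤ) else 0)) =
          (-1 : ℤ) ^ S.card * if ∀ e ∈ S, (e.map f).IsDiag then 1 else 0 := by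
      intro S
      rw [Finset.prod_neg, Finset.prod_boole]
      congr
    simp only [h5, Finset.prod_const_one, mul_one] at h4
    rw [← h4]
    split_ifs with h
    · apply Finset.prod_eq_one
      intro e
      induction e with | _ u v
      intro he
      rw [SimpleGraph.mem_edgeFinset, SimpleGraph.mem_edgeSet] at he
      simp [h u v he]
    · push Not at h
      obtain ⟨u, v, huv, hf⟩ := h
      refine Finset.prod_eq_zero (i := s(u, v)) ?_ ?_
      · simpa using huv
      · simp [hf]
  have hcol : (numColorings G k : ℤ) =
      ∑ f : V → Fin k, if ∀ u v, G.Adj u v → f u ≠ f v then 1 else 0 := by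
    have e : G.Coloring (Fin k) ≃ {f : V → Fin k // ∀ u v, G.Adj u v → f u ≠ f v} :=
      { toFun := fun c => ⟨c, fun _ _ h => c.valid h⟩
        invFun := fun f => SimpleGraph.Coloring.mk f.1 (fun {u v} h => f.2 u v h)
        left_inv := fun _ => rfl
        right_inv := fun _ => rfl }
    rw [numColorings, Nat.card_congr e, Nat.card_eq_fintype_card, Fintype.card_subtype,
      Finset.sum_boole]
  rw [hcol, Polynomial.eval_finsetSum]
  simp only [← hprod]
  rw [Finset.sum_comm]
  refine Finset.sum_congr rfl fun S hS => ?_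
  rw [← Finset.mul_sum, ← hcount S (Finset.mem_powerset.1 hS)]
  simp

/-- The chromatic polynomial `P(G, x)`: the polynomial whose value at every positive integer `k`
is the number of proper `k`-colorings of `G`. -/
def chromaticPolynomial {V : Type*} [Fintype V] (G : SimpleGraph V) : ℤ[X] :=
  Classical.choose (exists_chromaticPolynomial G)

/-- The defining property of the chromatic polynomial. -/
theorem chromaticPolynomial_eval {V : Type*} [Fintype V] (G : SimpleGraph V) (k : ℕ)
    (hk : 1 ≤ k) : (chromaticPolynomial G).eval (k : ℤ) = numColorings G k :=
  Classical.choose_spec (exists_chromaticPolynomial G) k hk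

/-- The chromatic polynomial is the only polynomial with its defining property. -/
theorem eq_chromaticPolynomial {V : Type*} [Fintype V] (G : SimpleGraph V) (P : ℤ[X])
    (hP : ∀ k : ℕ, 1 ≤ k → P.eval (k : ℤ) = numColorings G k) : P = chromaticPolynomial G := by
  refine Polynomial.eq_of_infinite_eval_eq _ _ (Set.Infinite.mono (s := (fun n : ℕ =>
    ((n + 1 : ℕ) : ℤ)) '' Set.univ) ?_ ?_)
  · rintro _ ⟨n, -, rfl⟩
    exact (hP _ (by omega)).trans (chromaticPolynomial_eval G _ (by omega)).symm
  · refine Set.infinite_univ.image ?_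
    intro a _ b _ h
    simpa using h

/-- For `1 ≤ i ≤ n = |V|`, the number `a_i(G)` with
`P(G, x) = ∑ i, (-1) ^ (n - i) * a_i(G) * x ^ i`. -/
def chromaticCoeff {V : Type*} [Fintype V] (G : SimpleGraph V) (i : ℕ) : ℤ :=
  (-1) ^ (Fintype.card V - i) * (chromaticPolynomial G).coeff i

/-! ### Acyclic orientations -/

/-- `D` is an orientation of `G`: every edge of `G` is an arc of `D` in exactly one of its
two directions, and `D` has no other arcs. -/
def IsOrientation {V : Type*} (G : SimpleGraph V) (D : Digraph V) : Prop :=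
  (∀ u v, G.Adj u v ↔ D.Adj u v ∨ D.Adj v u) ∧ ∀ u v, D.Adj u v → ¬ D.Adj v u

/-- `D` has no directed cycle, that is, no vertex is reached from itself by a directed walk of
positive length. -/
def IsAcyclic {V : Type*} (D : Digraph V) : Prop :=
  ∀ v, ¬ Relation.TransGen D.Adj v v

/-- A source is a vertex of in-degree zero. -/
def IsSource {V : Type*} (D : Digraph V) (v : V) : Prop :=
  ∀ u, ¬ D.Adj u v

/-- `α(H, w)`: the number of acyclic orientations of `H` with `w` as the unique source. -/
def alpha {V : Type*} (H : SimpleGraph V) (w : V) : ℕ :=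
  Nat.card {D : Digraph V //
    IsOrientation H D ∧ IsAcyclic D ∧ IsSource D w ∧ ∀ u, IsSource D u → u = w}

/-! ### Ordered partitions -/

/-- An element of `OP_{i,v}(V)`: an ordered partition `(part 0, …, part (i - 1))` of the vertex
set into nonempty parts that induce connected subgraphs, with `v` in the first part, such that
the least vertex in the union of any other part and all later parts is in the former part. -/
@[ext]
structure OrderedPartition {V : Type*} [LinearOrder V] (G : SimpleGraph V) (i : ℕ) (v : V) where
  /-- The parts. -/
  part : Fin i → Finset V
  nonempty : ∀ j, (part j).Nonempty
  disjoint : ∀ j k, j ≠ k → Disjoint (part j) (part k)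
  cover : ∀ u, ∃ j, u ∈ part j
  connected : ∀ j, (G.induce (part j : Set V)).Connected
  mem_first : ∀ hi : 0 < i, v ∈ part ⟨0, hi⟩
  least_mem : ∀ j : Fin i, 0 < j.val →
    ∃ m ∈ part j, IsLeast {u | ∃ s, j ≤ s ∧ u ∈ part s} m

instance {V : Type*} [Fintype V] [LinearOrder V] (G : SimpleGraph V) (i : ℕ) (v : V) :
    Fintype (OrderedPartition G i v) :=
  @Fintype.ofFinite _ (Finite.of_injective OrderedPartition.part fun _ _ h =>
    OrderedPartition.ext h)

/-- The vertex `v`, as a vertex of the subgraph induced by the first part. -/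
def OrderedPartition.root {V : Type*} [LinearOrder V] {G : SimpleGraph V} {i : ℕ} {v : V}
    (P : OrderedPartition G i v) (hi : 0 < i) : (P.part ⟨0, hi⟩ : Set V) :=
  ⟨v, P.mem_first hi⟩

/-- The least vertex `m_j` of the `j`-th part, as a vertex of the subgraph induced by it. -/
def OrderedPartition.least {V : Type*} [LinearOrder V] {G : SimpleGraph V} {i : ℕ} {v : V}
    (P : OrderedPartition G i v) (j : Fin i) : (P.part j : Set V) :=
  ⟨(P.part j).min' (P.nonempty j), (P.part j).min'_mem (P.nonempty j)⟩

end ChromaticCoeff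

end

/-! Write χ_A for the chromatic polynomial of G[A]. Splitting the palette into two blocks gives
χ_A(x + y) = ∑_{B ⊆ A} χ_B(x) χ_{A∖B}(y) (`chi_eval_add`). Singling out the color class B of a
vertex v ∈ A gives χ_A(x) = x ∑_{v ∈ B ⊆ A} χ_B(1) χ_{A∖B}(x - 1) (`chi_eval_eq_mul_sum`). Expanding
χ_{A∖B}(-1 + x) by the first identity and grouping by the union D of B with the set evaluated at -1
yields χ_A(x) = x ∑_{v ∈ D ⊆ A} c_v(D) χ_{A∖D}(x) with c_v(D) = ∑_{v ∈ B ⊆ D} χ_B(1) χ_{D∖B}(-1)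
(`chi_eq_X_mul_sum`).

By Stanley's theorem, χ(-1) counts acyclic orientations up to sign, and χ_B(1) tests whether B is
independent. So the terms of c_v(D) count acyclic orientations of G[D] in which all of B are
sources. The alternating sum over B ∋ v leaves only those whose source set is {v}, whence c_v(D) =
(-1)^(|D|+1) α(G[D], v) (`chiLinear_eq`).

Taking coefficients gives a recursion that splits off one part D and lowers i by one
(`signedCoeff_succ`). Rooting the first step at v and each later step at the least remaining vertex
produces exactly the ordered partitions. Connectedness of the parts costs nothing, since α vanishes
on disconnected graphs. -/

namespace ChromaticCoeff

/-! ### Counting colorings by color classes -/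

/-- The proper colorings of `G[A]` with colors in `κ`. -/
abbrev ProperColoring {V : Type*} (G : SimpleGraph V) (A : Finset V) (κ : Type*) : Type _ :=
  {c : A → κ // ∀ u w : A, G.Adj u w → c u ≠ c w}

theorem numColorings_induce {V : Type*} (G : SimpleGraph V) (A : Finset V) (k : ℕ) :
    numColorings (G.induce (A : Set V)) k = Nat.card (ProperColoring G A (Fin k)) :=
  Nat.card_congr ⟨fun c => ⟨fun u => c u, fun u w h => c.valid (v := u) (w := w) h⟩,
    fun c => SimpleGraph.Coloring.mk c.1 fun {u w} h => c.2 u w h, fun _ => rfl, fun _ => rfl⟩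

open scoped Classical in
/-- The vertices that a coloring of `G[A]` with two blocks of colors colors from the left block. -/
noncomputable def leftClass {V κ μ : Type*} [Fintype V] {G : SimpleGraph V} {A : Finset V}
    (c : ProperColoring G A (κ ⊕ μ)) : Finset V :=
  Finset.univ.filter fun u => ∃ h : u ∈ A, (c.1 ⟨u, h⟩).isLeft

theorem mem_leftClass {V κ μ : Type*} [Fintype V] {G : SimpleGraph V} {A : Finset V}
    (c : ProperColoring G A (κ ⊕ μ)) (u : V) :
    u ∈ leftClass c ↔ ∃ h : u ∈ A, (c.1 ⟨u, h⟩).isLeft := by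
  simp [leftClass]

theorem leftClass_subset {V κ μ : Type*} [Fintype V] {G : SimpleGraph V} {A : Finset V}
    (c : ProperColoring G A (κ ⊕ μ)) : leftClass c ⊆ A := fun u hu =>
  ((mem_leftClass c u).1 hu).1

/-- A coloring of `G[A]` whose left class is `B` is a pair of colorings of `G[B]` and
`G[A \ B]`. -/
def leftClassEquiv {V κ μ : Type*} [Fintype V] [DecidableEq V]
    (G : SimpleGraph V) {A B : Finset V} (hB : B ⊆ A) :
    {c : ProperColoring G A (κ ⊕ μ) // leftClass c = B} ≃
      ProperColoring G B κ × ProperColoring G (A \ B) μ where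
  toFun c :=
    have hl : ∀ u (h : u ∈ B), (c.1.1 ⟨u, hB h⟩).isLeft := fun u h => by
      rw [← c.2, mem_leftClass] at h
      exact h.2
    have hr : ∀ u (h : u ∈ A \ B), (c.1.1 ⟨u, (Finset.mem_sdiff.1 h).1⟩).isRight := fun u h => by
      have h1 := (Finset.mem_sdiff.1 h).2
      rw [← c.2, mem_leftClass] at h1
      rw [← Sum.not_isLeft]
      exact fun h2 => h1 ⟨_, h2⟩
    (⟨fun u => (c.1.1 ⟨u.1, hB u.2⟩).getLeft (hl u.1 u.2), by
        intro u w huw h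
        dsimp only at h
        exact c.1.2 ⟨u.1, hB u.2⟩ ⟨w.1, hB w.2⟩ huw
          (by rw [← Sum.inl_getLeft _ (hl u.1 u.2), ← Sum.inl_getLeft _ (hl w.1 w.2), h])⟩,
      ⟨fun u => (c.1.1 ⟨u.1, (Finset.mem_sdiff.1 u.2).1⟩).getRight (hr u.1 u.2), by
        intro u w huw h
        dsimp only at h
        exact c.1.2 ⟨u.1, (Finset.mem_sdiff.1 u.2).1⟩ ⟨w.1, (Finset.mem_sdiff.1 w.2).1⟩ huw
          (by rw [← Sum.inr_getRight _ (hr u.1 u.2), ← Sum.inr_getRight _ (hr w.1 w.2), h])⟩)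
  invFun p := ⟨⟨fun u => if h : u.1 ∈ B then Sum.inl (p.1.1 ⟨u.1, h⟩) else
      Sum.inr (p.2.1 ⟨u.1, Finset.mem_sdiff.2 ⟨u.2, h⟩⟩), by
        intro u w huw
        by_cases hu : u.1 ∈ B <;> by_cases hw : w.1 ∈ B <;> simp only [hu, hw, dite_true, dite_false]
        · exact fun h => p.1.2 ⟨u.1, hu⟩ ⟨w.1, hw⟩ huw (Sum.inl_injective h)
        · simp
        · simp
        · exact fun h => p.2.2 ⟨u.1, _⟩ ⟨w.1, _⟩ huw (Sum.inr_injective h)⟩, by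
      ext u
      rw [mem_leftClass]
      by_cases hu : u ∈ B
      · simp [hu, hB hu]
      · simp [hu]⟩
  left_inv c := by
    refine Subtype.ext (Subtype.ext (funext fun u => ?_))
    have h : u.1 ∈ B ↔ (c.1.1 u).isLeft := by
      conv_lhs => rw [← c.2, mem_leftClass]
      exact ⟨fun h => h.2, fun h => ⟨u.2, h⟩⟩
    by_cases hu : u.1 ∈ B <;> simp [hu]
  right_inv p := by
    refine Prod.ext (Subtype.ext (funext fun u => ?_)) (Subtype.ext (funext fun u => ?_))
    · simp
    · have hu : u.1 ∉ B := (Finset.mem_sdiff.1 u.2).2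
      simp [hu]

/-- Colorings are fibered over their left class B; each fiber is a product, because edges between B
and its complement are properly colored automatically. -/
theorem card_coloring_sum {V κ μ : Type*} [Fintype V] [DecidableEq V] [Finite κ] [Finite μ]
    (G : SimpleGraph V) (A : Finset V)
    (p : ProperColoring G A (κ ⊕ μ) → Prop) (q : Finset V → Prop) [DecidablePred q]
    (hpq : ∀ c, p c ↔ q (leftClass c)) :
    Nat.card {c // p c} = ∑ B ∈ A.powerset with q B,
      Nat.card (ProperColoring G B κ) *
        Nat.card (ProperColoring G (A \ B) μ) := by
  rw [Nat.card_congr (Equiv.sigmaFiberEquiv (fun c : {c // p c} => leftClass c.1)).symm,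
    Nat.card_sigma, ← Finset.sum_subset (Finset.subset_univ (A.powerset.filter q))]
  · refine Finset.sum_congr rfl fun B hB => ?_
    rw [Finset.mem_filter, Finset.mem_powerset] at hB
    rw [← Nat.card_prod, ← Nat.card_congr (leftClassEquiv G hB.1)]
    refine Nat.card_congr ⟨fun c => ⟨c.1.1, c.2⟩, fun c => ⟨⟨c.1, (hpq _).2 (c.2.symm ▸ hB.2)⟩,
      c.2⟩, fun _ => rfl, fun _ => rfl⟩
  · intro B _ hB
    rw [Nat.card_eq_zero]
    refine Or.inl ⟨fun c => hB ?_⟩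
    rw [Finset.mem_filter, Finset.mem_powerset, ← c.2]
    exact ⟨leftClass_subset _, (hpq _).1 c.1.2⟩

/-- Colorings transported along an equivalence of the colors. -/
def coloringCongr {V κ μ : Type*} (G : SimpleGraph V) (A : Finset V) (e : κ ≃ μ) :
    ProperColoring G A κ ≃ ProperColoring G A μ :=
  (Equiv.arrowCongr (Equiv.refl A) e).subtypeEquiv fun c => by simp

theorem numColorings_induce_add {V : Type*} [Fintype V] [DecidableEq V] (G : SimpleGraph V)
    (A : Finset V) (k l : ℕ) :
    numColorings (G.induce (A : Set V)) (k + l) = ∑ B ∈ A.powerset,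
      numColorings (G.induce (B : Set V)) k *
        numColorings (G.induce ((A \ B : Finset V) : Set V)) l := by
  have h := card_coloring_sum (κ := Fin k) (μ := Fin l) G A (fun _ => True) (fun _ => True)
    (fun _ => Iff.rfl)
  rw [Finset.filter_true] at h
  simp only [numColorings_induce]
  rw [Nat.card_congr (coloringCongr _ _ finSumFinEquiv.symm),
    ← Nat.card_congr (Equiv.subtypeUnivEquiv fun _ => trivial), h]

theorem numColorings_induce_succ {V : Type*} [Fintype V] [DecidableEq V] (G : SimpleGraph V)
    {A : Finset V} {v : V} (hv : v ∈ A) (k : ℕ) :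
    numColorings (G.induce (A : Set V)) (k + 1) = (k + 1) * ∑ B ∈ A.powerset with v ∈ B,
      numColorings (G.induce (B : Set V)) 1 *
        numColorings (G.induce ((A \ B : Finset V) : Set V)) k := by
  have h := card_coloring_sum (κ := Fin 1) (μ := Fin k) G A (fun c => (c.1 ⟨v, hv⟩).isLeft)
    (fun B => v ∈ B) (fun c => by
      rw [mem_leftClass]
      exact ⟨fun h => ⟨hv, h⟩, fun h => h.2⟩)
  have e0 : Fin (k + 1) ≃ Fin 1 ⊕ Fin k :=
    (finCongr (Nat.add_comm k 1)).trans finSumFinEquiv.symm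
  have key : ∀ j : Fin (k + 1), Nat.card {c : ProperColoring G A (Fin (k + 1)) //
      c.1 ⟨v, hv⟩ = j} = Nat.card {c : ProperColoring G A (Fin 1 ⊕ Fin k) //
      (c.1 ⟨v, hv⟩).isLeft} := by
    intro j
    -- The swap turns the prescribed color `j` into the only color of the left block.
    let e := e0.trans (Equiv.swap (e0 j) (Sum.inl 0))
    have hej : e j = Sum.inl 0 := by simp [e]
    refine Nat.card_congr ((coloringCongr _ _ e).subtypeEquiv fun c => ?_)
    change c.1 ⟨v, hv⟩ = j ↔ (e (c.1 ⟨v, hv⟩)).isLeft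
    rw [← e.injective.eq_iff, hej]
    constructor
    · intro h
      rw [h]
      rfl
    · intro h
      obtain ⟨y, hy⟩ := Sum.isLeft_iff.1 h
      rw [hy, Subsingleton.elim y 0]
  simp only [numColorings_induce]
  rw [Nat.card_congr (Equiv.sigmaFiberEquiv
    (fun c : ProperColoring G A (Fin (k + 1)) => c.1 ⟨v, hv⟩)).symm, Nat.card_sigma,
    Finset.sum_congr rfl fun j _ => key j, h]
  simp

/-! ### Identities for chromatic polynomials of induced subgraphs -/

/-- Two integer polynomials that agree at all positive integers are equal. -/
theorem polynomial_eq_of_eval_nat {P Q : ℤ[X]}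
    (h : ∀ k : ℕ, 1 ≤ k → P.eval (k : ℤ) = Q.eval (k : ℤ)) : P = Q := by
  refine Polynomial.eq_of_infinite_eval_eq _ _ (Set.Infinite.mono (s := (fun n : ℕ =>
    ((n + 1 : ℕ) : ℤ)) '' Set.univ) ?_ ?_)
  · rintro _ ⟨n, -, rfl⟩
    exact h _ (by omega)
  · refine Set.infinite_univ.image ?_
    intro a _ b _ h
    simpa using h

/-- The chromatic polynomial of the subgraph of `G` induced by `A`. -/
noncomputable def chi {V : Type*} (G : SimpleGraph V) (A : Finset V) : ℤ[X] :=
  chromaticPolynomial (G.induce (A : Set V))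

theorem chi_eval {V : Type*} (G : SimpleGraph V) (A : Finset V) {k : ℕ} (hk : 1 ≤ k) :
    (chi G A).eval (k : ℤ) = numColorings (G.induce (A : Set V)) k :=
  chromaticPolynomial_eval _ k hk

theorem chi_univ {V : Type*} [Fintype V] (G : SimpleGraph V) :
    chi G Finset.univ = chromaticPolynomial G := by
  refine eq_chromaticPolynomial G _ fun k hk => ?_
  rw [chi_eval G _ hk, numColorings_induce, numColorings, Nat.cast_inj]
  exact Nat.card_congr ⟨fun c => SimpleGraph.Coloring.mk (fun u => c.1 ⟨u, Finset.mem_univ u⟩)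
      fun {u w} h => c.2 ⟨u, _⟩ ⟨w, _⟩ h,
    fun c => ⟨fun u => c u.1, fun u w h => c.valid h⟩, fun _ => rfl, fun _ => rfl⟩

theorem chi_empty {V : Type*} (G : SimpleGraph V) : chi G ∅ = 1 := by
  refine polynomial_eq_of_eval_nat fun k hk => ?_
  rw [chi_eval G _ hk, numColorings_induce]
  have : Unique (ProperColoring G ∅ (Fin k)) :=
    ⟨⟨fun u => isEmptyElim u, fun u => isEmptyElim u⟩,
      fun c => Subtype.ext (funext fun u => isEmptyElim u)⟩
  simp

theorem chi_eval_add {V : Type*} [Fintype V] [DecidableEq V] (G : SimpleGraph V) (A : Finset V)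
    (x y : ℤ) : (chi G A).eval (x + y) =
      ∑ B ∈ A.powerset, (chi G B).eval x * (chi G (A \ B)).eval y := by
  -- The two variables are freed one at a time: first x with y a positive integer, then y with x an
  -- arbitrary integer.
  have h1 : ∀ k : ℕ, 1 ≤ k → (chi G A).comp (X + C (k : ℤ)) =
      ∑ B ∈ A.powerset, chi G B * C ((chi G (A \ B)).eval (k : ℤ)) := by
    intro k hk
    refine polynomial_eq_of_eval_nat fun l hl => ?_
    simp only [eval_comp, eval_add, eval_X, eval_C, eval_finsetSum, eval_mul]
    rw [← Nat.cast_add, chi_eval G A (by omega), numColorings_induce_add]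
    push_cast
    exact Finset.sum_congr rfl fun B _ => by rw [chi_eval G _ hl, chi_eval G _ hk]
  have h2 : (chi G A).comp (C x + X) =
      ∑ B ∈ A.powerset, C ((chi G B).eval x) * chi G (A \ B) := by
    refine polynomial_eq_of_eval_nat fun k hk => ?_
    have := congrArg (eval x) (h1 k hk)
    simpa [eval_finsetSum] using this
  have := congrArg (eval y) h2
  simpa [eval_finsetSum] using this

theorem chi_eval_eq_mul_sum {V : Type*} [Fintype V] [DecidableEq V] (G : SimpleGraph V)
    {A : Finset V} {v : V} (hv : v ∈ A) (x : ℤ) : (chi G A).eval x =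
      x * ∑ B ∈ A.powerset with v ∈ B, (chi G B).eval 1 * (chi G (A \ B)).eval (x - 1) := by
  -- The shift by one keeps every evaluation at a positive integer, where colorings are counted.
  have h : (chi G A).comp (X + 1) = (X + 1) * ∑ B ∈ A.powerset with v ∈ B,
      C ((chi G B).eval 1) * chi G (A \ B) := by
    refine polynomial_eq_of_eval_nat fun k hk => ?_
    simp only [eval_comp, eval_add, eval_X, eval_C, eval_finsetSum, eval_mul, eval_one]
    rw [← Nat.cast_one (R := ℤ), ← Nat.cast_add, chi_eval G A (by omega),
      numColorings_induce_succ G hv]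
    push_cast
    congr 1
    refine Finset.sum_congr rfl fun B _ => ?_
    rw [chi_eval G _ hk, ← Nat.cast_one (R := ℤ), chi_eval G _ le_rfl]
  have := congrArg (eval (x - 1)) h
  simpa [eval_finsetSum] using this

theorem chi_eval_zero {V : Type*} [Fintype V] [DecidableEq V] (G : SimpleGraph V)
    (A : Finset V) : (chi G A).eval 0 = if A = ∅ then 1 else 0 := by
  split_ifs with h
  · rw [h, chi_empty, eval_one]
  · obtain ⟨v, hv⟩ := Finset.nonempty_iff_ne_empty.2 h
    rw [chi_eval_eq_mul_sum G hv, zero_mul]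

/-- The linear coefficient of the chromatic polynomial of `G[A]`, expanded at `v`. -/
noncomputable def chiLinear {V : Type*} [DecidableEq V] (G : SimpleGraph V) (v : V)
    (A : Finset V) : ℤ :=
  ∑ B ∈ A.powerset with v ∈ B, (chi G B).eval 1 * (chi G (A \ B)).eval (-1)

/-- Writing x - 1 as -1 + x moves the shift into the constant factor, so the remaining polynomial
has argument x and coefficients can be compared directly. -/
theorem chi_eq_X_mul_sum {V : Type*} [Fintype V] [DecidableEq V] (G : SimpleGraph V)
    {A : Finset V} {v : V} (hv : v ∈ A) : chi G A =
      X * ∑ D ∈ A.powerset with v ∈ D, C (chiLinear G v D) * chi G (A \ D) := by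
  refine polynomial_eq_of_eval_nat fun k _ => ?_
  rw [chi_eval_eq_mul_sum G hv]
  simp only [eval_mul, eval_X, eval_finsetSum, eval_C, chiLinear]
  congr 1
  simp only [sub_eq_neg_add, chi_eval_add, Finset.mul_sum, Finset.sum_mul]
  rw [Finset.sum_sigma', Finset.sum_sigma']
  -- A disjoint pair (B, E) with v ∈ B corresponds to (D, B) with D = B ∪ E.
  refine Finset.sum_bij' (fun p _ => ⟨p.1 ∪ p.2, p.1⟩) (fun p _ => ⟨p.2, p.1 \ p.2⟩) ?_ ?_ ?_ ?_ ?_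
  · rintro ⟨B, E⟩ h
    simp only [Finset.mem_sigma, Finset.mem_filter, Finset.mem_powerset] at h ⊢
    grind
  · rintro ⟨D, B⟩ h
    simp only [Finset.mem_sigma, Finset.mem_filter, Finset.mem_powerset] at h ⊢
    grind
  · rintro ⟨B, E⟩ h
    simp only [Finset.mem_sigma, Finset.mem_filter, Finset.mem_powerset] at h
    have : (B ∪ E) \ B = E := by grind
    simp [this]
  · rintro ⟨D, B⟩ h
    simp only [Finset.mem_sigma, Finset.mem_filter, Finset.mem_powerset] at h
    have : B ∪ D \ B = D := by grind
    simp [this]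
  · rintro ⟨B, E⟩ h
    simp only [Finset.mem_sigma, Finset.mem_filter, Finset.mem_powerset] at h
    have h1 : (B ∪ E) \ B = E := by grind
    have h2 : A \ (B ∪ E) = (A \ B) \ E := by grind
    simp only [h1, h2]
    ring

/-! ### Acyclic orientations with prescribed sources -/

/-- The edges of `G` inside `A`, as a graph on all the vertices of `G`. -/
def restrict {V : Type*} (G : SimpleGraph V) (A : Finset V) : SimpleGraph V where
  Adj u w := G.Adj u w ∧ u ∈ A ∧ w ∈ A
  symm := ⟨fun _ _ h => ⟨h.1.symm, h.2.2, h.2.1⟩⟩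
  loopless := ⟨fun _ h => h.1.ne rfl⟩

instance {V : Type*} [Finite V] : Finite (Digraph V) :=
  Finite.of_injective Digraph.Adj fun _ _ h => Digraph.ext h

open scoped Classical in
noncomputable instance {V : Type*} [Finite V] : Fintype (Digraph V) := Fintype.ofFinite _

open scoped Classical in
/-- The acyclic orientations of `G[A]`. -/
noncomputable def acyclicOrientations {V : Type*} [Fintype V] (G : SimpleGraph V)
    (A : Finset V) : Finset (Digraph V) :=
  Finset.univ.filter fun D => IsOrientation (restrict G A) D ∧ IsAcyclic D

open scoped Classical in
/-- The sources of `D` in `A`. -/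
noncomputable def sources {V : Type*} (D : Digraph V) (A : Finset V) : Finset V :=
  A.filter (IsSource D)

theorem mem_acyclicOrientations {V : Type*} [Fintype V] {G : SimpleGraph V} {A : Finset V}
    {D : Digraph V} : D ∈ acyclicOrientations G A ↔
      IsOrientation (restrict G A) D ∧ IsAcyclic D := by
  simp [acyclicOrientations]

theorem mem_sources {V : Type*} {D : Digraph V} {A : Finset V} {u : V} :
    u ∈ sources D A ↔ u ∈ A ∧ IsSource D u := by
  simp [sources]

theorem wellFounded_of_isAcyclic {V : Type*} [Finite V] {D : Digraph V} (h : IsAcyclic D) :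
    WellFounded D.Adj := by
  have : IsTrans V (Relation.TransGen D.Adj) := ⟨fun _ _ _ => Relation.TransGen.trans⟩
  have : Std.Irrefl (Relation.TransGen D.Adj) := ⟨h⟩
  exact Subrelation.wf (fun h => Relation.TransGen.single h)
    (Finite.wellFounded_of_trans_of_irrefl (Relation.TransGen D.Adj))

theorem sources_nonempty {V : Type*} [Fintype V] {G : SimpleGraph V} {A : Finset V}
    (hA : A.Nonempty) {D : Digraph V} (hD : D ∈ acyclicOrientations G A) :
    (sources D A).Nonempty := by
  rw [mem_acyclicOrientations] at hD
  obtain ⟨m, hm, hmin⟩ := (wellFounded_of_isAcyclic hD.2).has_min (A : Set V) hA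
  refine ⟨m, ?_⟩
  rw [mem_sources]
  exact ⟨hm, fun u hu => hmin u ((hD.1.1 _ _).2 (Or.inl hu)).2.1 hu⟩

/-- Deleting the vertices of `B` from a digraph. -/
def deleteVertices {V : Type*} (D : Digraph V) (B : Finset V) : Digraph V where
  Adj u w := D.Adj u w ∧ u ∉ B ∧ w ∉ B

/-- Adding to `D` the edges of `G` from `B` to `A \ B`, directed away from `B`. -/
def addSources {V : Type*} (G : SimpleGraph V) (A : Finset V) (D : Digraph V) (B : Finset V) :
    Digraph V where
  Adj u w := D.Adj u w ∨ u ∈ B ∧ w ∈ A ∧ w ∉ B ∧ G.Adj u w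

/-- The acyclic orientations of `G[A]` in which all the vertices of the independent set `B` are
sources correspond to the acyclic orientations of `G[A \ B]`. -/
theorem card_acyclicOrientations_sources {V : Type*} [Fintype V] [DecidableEq V]
    (G : SimpleGraph V) {A B : Finset V} (hB : B ⊆ A)
    (hind : ∀ u ∈ B, ∀ w ∈ B, ¬ G.Adj u w) :
    ((acyclicOrientations G A).filter fun D => B ⊆ sources D A).card =
      (acyclicOrientations G (A \ B)).card := by
  have hsub : ∀ D : Digraph V, B ⊆ sources D A ↔ ∀ b ∈ B, IsSource D b := fun D => by
    simp only [Finset.subset_iff, mem_sources]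
    exact ⟨fun h b hb => (h hb).2, fun h b hb => ⟨hB hb, h b hb⟩⟩
  refine Finset.card_bij' (fun D _ => deleteVertices D B) (fun D _ => addSources G A D B)
    ?_ ?_ ?_ ?_
  · intro D hD
    rw [Finset.mem_filter, mem_acyclicOrientations] at hD
    obtain ⟨⟨⟨h1, h2⟩, h3⟩, -⟩ := hD
    rw [mem_acyclicOrientations]
    refine ⟨⟨fun u w => ?_, fun u w h h' => h2 u w h.1 h'.1⟩, fun u hu => h3 u ?_⟩
    · have := h1 u w
      simp only [restrict, deleteVertices, Finset.mem_sdiff] at this ⊢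
      tauto
    · exact hu.lift id fun _ _ h => h.1
  · intro D hD
    rw [mem_acyclicOrientations] at hD
    obtain ⟨⟨h1, h2⟩, h3⟩ := hD
    have hDB : ∀ u w, D.Adj u w → u ∉ B ∧ w ∉ B := fun u w h => by
      have := (h1 u w).2 (Or.inl h)
      simp only [restrict, Finset.mem_sdiff] at this
      tauto
    have hhead : ∀ u w, (addSources G A D B).Adj u w → w ∉ B := by
      rintro u w (h | h)
      · exact (hDB u w h).2
      · exact h.2.2.1
    rw [Finset.mem_filter, mem_acyclicOrientations, hsub]
    refine ⟨⟨⟨fun u w => ?_, ?_⟩, ?_⟩, fun b hb u hu => hhead _ _ hu hb⟩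
    · have h4 := h1 u w
      have h5 := hind u
      have h6 := G.adj_comm u w
      have h7 := @hB u
      have h8 := @hB w
      simp only [restrict, addSources, Finset.mem_sdiff] at h4 ⊢
      by_cases hu : u ∈ B <;> by_cases hw : w ∈ B
      · simp only [hu, hw, h5 hu w hw, not_true_eq_false, and_false, false_and, false_iff,
          or_false] at h4 ⊢
        exact h4
      · simp only [hu, hw, h7 hu, not_true_eq_false, not_false_eq_true, and_false, false_and,
          true_and, and_true, or_false, false_iff, not_or] at h4 ⊢
        tauto
      · simp only [hu, hw, h8 hw, not_true_eq_false, not_false_eq_true, and_false, false_and,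
          true_and, and_true, or_false, false_iff, not_or] at h4 ⊢
        tauto
      · simp only [hu, hw, not_false_eq_true, and_true, false_and, or_false] at h4 ⊢
        exact h4
    · rintro u w (h | h) (h' | h')
      · exact h2 u w h h'
      · exact (hDB u w h).2 h'.1
      · exact (hDB w u h').2 h.1
      · exact h.2.2.1 h'.1
    -- No arc enters B, so a walk starting outside B stays outside and uses only arcs of `D`; a
    -- closed walk cannot meet B at all.
    · have key : ∀ u w, u ∉ B → Relation.TransGen (addSources G A D B).Adj u w →
          Relation.TransGen D.Adj u w ∧ w ∉ B := by
        intro u w hu h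
        induction h with
        | single h =>
          exact ⟨.single (h.resolve_right fun h' => hu h'.1), hhead _ _ h⟩
        | tail _ h ih =>
          exact ⟨ih.1.tail (h.resolve_right fun h' => ih.2 h'.1), hhead _ _ h⟩
      intro u hu
      have huB : u ∉ B := by
        cases hu with
        | single h => exact hhead _ _ h
        | tail _ h => exact hhead _ _ h
      exact h3 u (key u u huB hu).1
  · intro D hD
    rw [Finset.mem_filter, mem_acyclicOrientations, hsub] at hD
    obtain ⟨⟨⟨h1, h2⟩, h3⟩, h4⟩ := hD
    ext u w
    have h5 := h1 u w
    have h6 : D.Adj u w → w ∉ B := fun h hw => h4 w hw u h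
    have h7 : D.Adj w u → u ∉ B := fun h hw => h4 u hw w h
    have h8 := @hB u
    simp only [addSources, deleteVertices, restrict] at h5 ⊢
    tauto
  · intro D hD
    rw [mem_acyclicOrientations] at hD
    obtain ⟨⟨h1, h2⟩, h3⟩ := hD
    ext u w
    have h5 := h1 u w
    simp only [addSources, deleteVertices, restrict, Finset.mem_sdiff] at h5 ⊢
    tauto

theorem card_acyclicOrientations_sources_eq_zero {V : Type*} [Fintype V] [DecidableEq V]
    (G : SimpleGraph V) {A B : Finset V} (hB : B ⊆ A)
    (hind : ¬ ∀ u ∈ B, ∀ w ∈ B, ¬ G.Adj u w) :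
    ((acyclicOrientations G A).filter fun D => B ⊆ sources D A).card = 0 := by
  push Not at hind
  obtain ⟨u, hu, w, hw, h⟩ := hind
  rw [Finset.card_eq_zero, Finset.filter_eq_empty_iff]
  intro D hD hs
  rw [mem_acyclicOrientations] at hD
  rcases (hD.1.1 u w).1 ⟨h, hB hu, hB hw⟩ with h | h
  · exact (mem_sources.1 (hs hw)).2 _ h
  · exact (mem_sources.1 (hs hu)).2 _ h

open scoped Classical in
theorem chi_eval_one {V : Type*} (G : SimpleGraph V) (B : Finset V) :
    (chi G B).eval 1 = if ∀ u ∈ B, ∀ w ∈ B, ¬ G.Adj u w then 1 else 0 := by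
  rw [← Nat.cast_one (R := ℤ), chi_eval G B le_rfl, numColorings_induce]
  split_ifs with h
  · have : Unique (ProperColoring G B (Fin 1)) :=
      ⟨⟨fun _ => 0, fun u w huw => (h u u.2 w w.2 huw).elim⟩,
        fun c => Subtype.ext (Subsingleton.elim _ _)⟩
    simp
  · push Not at h
    obtain ⟨u, hu, w, hw, h⟩ := h
    have : IsEmpty (ProperColoring G B (Fin 1)) :=
      ⟨fun c => c.2 ⟨u, hu⟩ ⟨w, hw⟩ h (Subsingleton.elim _ _)⟩
    simp

/-- Adjacent vertices cannot both be sources, and the factor χ_B(1) is the indicator of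
independence. -/
theorem card_acyclicOrientations_sources_eq_mul {V : Type*} [Fintype V] [DecidableEq V]
    (G : SimpleGraph V) {A B : Finset V} (hB : B ⊆ A) :
    (((acyclicOrientations G A).filter fun D => B ⊆ sources D A).card : ℤ) =
      (chi G B).eval 1 * (acyclicOrientations G (A \ B)).card := by
  rw [chi_eval_one]
  split_ifs with h
  · rw [card_acyclicOrientations_sources G hB h, one_mul]
  · rw [card_acyclicOrientations_sources_eq_zero G hB h, zero_mul, Nat.cast_zero]

/-! ### Stanley's theorem and orientations with a unique source -/

/-- Inclusion-exclusion over the sources. -/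
theorem sum_acyclicOrientations {V : Type*} [Fintype V] [DecidableEq V]
    (G : SimpleGraph V) (A : Finset V) (q : Finset V → Prop) [DecidablePred q] :
    ∑ B ∈ A.powerset with q B, (-1 : ℤ) ^ B.card *
        ((chi G B).eval 1 * (acyclicOrientations G (A \ B)).card) =
      ∑ D ∈ acyclicOrientations G A, ∑ B ∈ (sources D A).powerset with q B,
        (-1 : ℤ) ^ B.card := by
  have h : ∀ B ∈ A.powerset.filter q, (-1 : ℤ) ^ B.card *
        ((chi G B).eval 1 * (acyclicOrientations G (A \ B)).card) =
      ∑ D ∈ acyclicOrientations G A with B ⊆ sources D A, (-1 : ℤ) ^ B.card := by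
    intro B hB
    rw [Finset.mem_filter, Finset.mem_powerset] at hB
    rw [← card_acyclicOrientations_sources_eq_mul G hB.1, Finset.sum_const, nsmul_eq_mul,
      mul_comm]
  rw [Finset.sum_congr rfl h]
  -- Both sides sum the sign of B over pairs with B contained in the source set of D.
  refine Finset.sum_comm' fun B D => ?_
  simp only [Finset.mem_filter, Finset.mem_powerset]
  have : sources D A ⊆ A := fun u hu => (mem_sources.1 hu).1
  exact ⟨fun h => ⟨⟨h.2.2, h.1.2⟩, h.2.1⟩, fun h => ⟨⟨h.1.1.trans this, h.1.2⟩, h.2, h.1.1⟩⟩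

/-- Stanley's theorem on the number of acyclic orientations. -/
theorem chi_eval_neg_one {V : Type*} [Fintype V] [DecidableEq V] (G : SimpleGraph V)
    (A : Finset V) : (chi G A).eval (-1) = (-1) ^ A.card * (acyclicOrientations G A).card := by
  induction A using Finset.strongInduction with
  | H A ih =>
    by_cases hA : A = ∅
    · subst hA
      have : acyclicOrientations G ∅ = {⟨fun _ _ => False⟩} := by
        ext D
        rw [mem_acyclicOrientations, Finset.mem_singleton]
        constructor
        · intro h
          ext u w
          exact ⟨fun h' => by simpa [restrict] using (h.1.1 u w).2 (Or.inl h'), False.elim⟩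
        · rintro rfl
          refine ⟨⟨by simp [restrict], fun _ _ h => h.elim⟩, fun u hu => ?_⟩
          cases hu with
          | single h => exact h
          | tail _ h => exact h
      rw [chi_empty, this]
      simp
    · have h1 := sum_acyclicOrientations G A (fun _ => True)
      have h2 := chi_eval_add G A 1 (-1)
      rw [Finset.filter_true] at h1
      rw [Finset.sum_eq_zero (s := acyclicOrientations G A)] at h1
      · rw [add_neg_cancel, chi_eval_zero, if_neg hA] at h2
        -- `h2` expands 0 = χ_A(1 - 1), and `h1` is the alternating sum over the nonempty source
        -- sets. The terms with B ≠ ∅ agree by induction, so those with B = ∅, the two sides of the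
        -- claim, agree as well.
        have h3 := congrArg (fun x => (-1) ^ A.card * x) h1
        simp only [mul_zero, Finset.mul_sum] at h3
        rw [← Finset.add_sum_erase _ _ (Finset.empty_mem_powerset A)] at h2 h3
        have h4 : ∀ B ∈ A.powerset.erase ∅, (-1) ^ A.card * ((-1 : ℤ) ^ B.card *
            ((chi G B).eval 1 * (acyclicOrientations G (A \ B)).card)) =
            (chi G B).eval 1 * (chi G (A \ B)).eval (-1) := by
          intro B hB
          rw [Finset.mem_erase, Finset.mem_powerset] at hB
          rw [ih _ (Finset.sdiff_ssubset hB.2 (Finset.nonempty_iff_ne_empty.2 hB.1)),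
            ← Finset.card_sdiff_add_card_eq_card hB.2, pow_add]
          have : ((-1 : ℤ) ^ B.card) * (-1) ^ B.card = 1 := by
            rw [← mul_pow]; simp
          linear_combination ((-1) ^ (A \ B).card * (chi G B).eval 1 *
            (acyclicOrientations G (A \ B)).card) * this
        rw [Finset.sum_congr rfl h4] at h3
        simp only [chi_empty, Finset.card_empty, Finset.sdiff_empty, eval_one, one_mul,
          pow_zero] at h2 h3
        linarith
      · intro D hD
        rw [Finset.filter_true]
        exact Finset.sum_powerset_neg_one_pow_card_of_nonempty
          (sources_nonempty (Finset.nonempty_iff_ne_empty.2 hA) hD)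

/-- Removing v from B leaves minus the alternating sum over all subsets of S ∖ {v}, which vanishes
unless that set is empty. -/
theorem sum_powerset_mem_neg_one_pow_card {α : Type*} [DecidableEq α] (S : Finset α) (v : α) :
    ∑ B ∈ S.powerset with v ∈ B, (-1 : ℤ) ^ B.card = if S = {v} then -1 else 0 := by
  by_cases hv : v ∈ S
  · have h : ∑ B ∈ S.powerset with v ∈ B, (-1 : ℤ) ^ B.card =
        ∑ B ∈ (S.erase v).powerset, -(-1 : ℤ) ^ B.card := by
      refine Finset.sum_bij' (fun B _ => B.erase v) (fun B _ => insert v B) ?_ ?_ ?_ ?_ ?_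
      · intro B hB
        simp only [Finset.mem_filter, Finset.mem_powerset] at hB ⊢
        exact Finset.erase_subset_erase _ hB.1
      · intro B hB
        simp only [Finset.mem_filter, Finset.mem_powerset] at hB ⊢
        grind
      · intro B hB
        exact Finset.insert_erase (Finset.mem_filter.1 hB).2
      · intro B hB
        rw [Finset.mem_powerset] at hB
        exact Finset.erase_insert fun h => by simpa using hB h
      · intro B hB
        rw [← Finset.card_erase_add_one (Finset.mem_filter.1 hB).2, pow_succ]
        ring
    rw [h, Finset.sum_neg_distrib, Finset.sum_powerset_neg_one_pow_card]
    have : S.erase v = ∅ ↔ S = {v} := by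
      rw [Finset.erase_eq_empty_iff]
      exact ⟨fun h => h.resolve_left (Finset.ne_empty_of_mem hv), Or.inr⟩
    simp only [this]
    split_ifs <;> simp
  · rw [if_neg (by rintro rfl; simp at hv)]
    refine Finset.sum_eq_zero fun B hB => ?_
    rw [Finset.mem_filter, Finset.mem_powerset] at hB
    exact (hv (hB.1 hB.2)).elim

/-- The number of acyclic orientations of `G[A]` with `v` as the unique source, `0` if `v` is not
in `A`. -/
noncomputable def alphaOn {V : Type*} [DecidableEq V] (G : SimpleGraph V) (A : Finset V)
    (v : V) : ℕ :=
  if h : v ∈ A then alpha (G.induce (A : Set V)) ⟨v, h⟩ else 0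

/-- A digraph on `A`, as a digraph on all the vertices. -/
def extendDigraph {V : Type*} {A : Finset V} (D : Digraph (A : Set V)) : Digraph V where
  Adj u w := ∃ (hu : u ∈ A) (hw : w ∈ A), D.Adj ⟨u, hu⟩ ⟨w, hw⟩

/-- Passes from digraphs on the subtype to digraphs on V. Vertices outside A become isolated, hence
sources, which is why only the sources in A are compared. -/
theorem alphaOn_eq_card {V : Type*} [Fintype V] [DecidableEq V] (G : SimpleGraph V)
    {A : Finset V} {v : V} (hv : v ∈ A) :
    alphaOn G A v = ((acyclicOrientations G A).filter fun D => sources D A = {v}).card := by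
  have hsrc : ∀ D : Digraph V, D ∈ acyclicOrientations G A →
      ∀ u : (A : Set V), IsSource D u.1 ↔ ∀ w : (A : Set V), ¬ D.Adj w u := fun D hD u =>
    ⟨fun h w => h w, fun h w hw => h ⟨w, (((mem_acyclicOrientations.1 hD).1.1 _ _).2
      (Or.inl hw)).2.1⟩ hw⟩
  have huniq : ∀ D : Digraph V, sources D A = {v} ↔
      IsSource D v ∧ ∀ u : (A : Set V), IsSource D u.1 → u = ⟨v, hv⟩ := by
    intro D
    simp only [Finset.eq_singleton_iff_unique_mem, mem_sources, Subtype.forall,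
      Subtype.mk.injEq, Finset.mem_coe]
    tauto
  rw [alphaOn, dif_pos hv, alpha, ← Fintype.card_coe,
    ← Nat.card_eq_fintype_card]
  refine Nat.card_congr ⟨fun D => ⟨extendDigraph D.1, ?_⟩,
    fun D => ⟨⟨fun u w => D.1.Adj u w⟩, ?_⟩, fun D => ?_, fun D => ?_⟩
  · obtain ⟨D, ⟨h1, h2⟩, h3, h4, h5⟩ := D
    have hadj : ∀ u w : (A : Set V), (extendDigraph D).Adj u w ↔ D.Adj u w := fun u w =>
      ⟨fun h => h.2.2, fun h => ⟨u.2, w.2, h⟩⟩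
    have hac : extendDigraph D ∈ acyclicOrientations G A := by
      rw [mem_acyclicOrientations]
      refine ⟨⟨fun u w => ⟨?_, ?_⟩, ?_⟩, ?_⟩
      · rintro ⟨h, hu, hw⟩
        exact ((h1 ⟨u, hu⟩ ⟨w, hw⟩).1 h).imp (fun h => ⟨hu, hw, h⟩) (fun h => ⟨hw, hu, h⟩)
      · rintro (⟨hu, hw, h⟩ | ⟨hw, hu, h⟩)
        · exact ⟨(h1 _ _).2 (Or.inl h), hu, hw⟩
        · exact ⟨(h1 ⟨u, hu⟩ ⟨w, hw⟩).2 (Or.inr h), hu, hw⟩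
      · rintro u w ⟨hu, hw, h⟩ ⟨_, _, h'⟩
        exact h2 _ _ h h'
      · have key : ∀ u w, Relation.TransGen (extendDigraph D).Adj u w →
            ∃ (hu : u ∈ A) (hw : w ∈ A), Relation.TransGen D.Adj ⟨u, hu⟩ ⟨w, hw⟩ := by
          intro u w h
          induction h with
          | single h => exact ⟨h.1, h.2.1, .single h.2.2⟩
          | tail _ h ih =>
            obtain ⟨hu, _, h6⟩ := ih
            exact ⟨hu, h.2.1, h6.tail h.2.2⟩
        intro u hu
        obtain ⟨_, _, h6⟩ := key u u hu
        exact h3 _ h6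
    rw [Finset.mem_filter, huniq]
    have hsrc' : ∀ u : (A : Set V), IsSource (extendDigraph D) u.1 ↔ IsSource D u := fun u => by
      rw [hsrc _ hac]
      simp only [hadj, IsSource]
    exact ⟨hac, (hsrc' ⟨v, hv⟩).2 h4, fun u hu => h5 u ((hsrc' u).1 hu)⟩
  · obtain ⟨D, hD⟩ := D
    rw [Finset.mem_filter, huniq] at hD
    obtain ⟨hac, h4, h5⟩ := hD
    obtain ⟨⟨h1, h2⟩, h3⟩ := mem_acyclicOrientations.1 hac
    refine ⟨⟨fun u w => ?_, fun u w => h2 u w⟩, fun u hu => h3 u.1 ?_,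
      (hsrc D hac ⟨v, hv⟩).1 h4, fun u hu => h5 u ((hsrc D hac u).2 hu)⟩
    · rw [← h1]
      exact ⟨fun h => ⟨h, u.2, w.2⟩, fun h => h.1⟩
    · exact hu.lift Subtype.val fun _ _ h => h
  · refine Subtype.ext (Digraph.ext ?_)
    funext u w
    exact propext ⟨fun h => h.2.2, fun h => ⟨u.2, w.2, h⟩⟩
  · refine Subtype.ext (Digraph.ext ?_)
    funext u w
    have h := ((mem_acyclicOrientations.1 (Finset.mem_filter.1 D.2).1).1.1 u w)
    exact propext ⟨fun h => h.2.2, fun h' => have h6 := (h.2 (Or.inl h')).2; ⟨h6.1, h6.2, h'⟩⟩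

/-- Stanley's theorem turns the defining sum into inclusion-exclusion over the sets of sources
containing `v`. -/
theorem chiLinear_eq {V : Type*} [Fintype V] [DecidableEq V] (G : SimpleGraph V)
    {A : Finset V} {v : V} (hv : v ∈ A) :
    chiLinear G v A = (-1) ^ (A.card + 1) * alphaOn G A v := by
  have h := sum_acyclicOrientations G A (fun B => v ∈ B)
  simp only [sum_powerset_mem_neg_one_pow_card] at h
  rw [← Finset.sum_filter, Finset.sum_const, nsmul_eq_mul, ← alphaOn_eq_card G hv] at h
  have h3 := congrArg (fun x => (-1) ^ A.card * x) h
  simp only [Finset.mul_sum] at h3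
  rw [pow_succ, mul_assoc, mul_comm (-1 : ℤ), ← h3, chiLinear]
  refine Finset.sum_congr rfl fun B hB => ?_
  rw [Finset.mem_filter, Finset.mem_powerset] at hB
  rw [chi_eval_neg_one, ← Finset.card_sdiff_add_card_eq_card hB.1, pow_add]
  have : ((-1 : ℤ) ^ B.card) * (-1) ^ B.card = 1 := by
    rw [← mul_pow]; simp
  linear_combination -((-1) ^ (A \ B).card * (chi G B).eval 1 *
    (acyclicOrientations G (A \ B)).card) * this

/-- Following arcs backwards from any vertex ends at a source, which can only be `w`. -/
theorem connected_of_alpha_ne_zero {V : Type*} [Finite V] {H : SimpleGraph V} {w : V}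
    (h : alpha H w ≠ 0) : H.Connected := by
  obtain ⟨⟨D, h1, h2, h3, h4⟩⟩ := (Nat.card_ne_zero.1 h).1
  have key : ∀ u, H.Reachable u w := by
    intro u
    induction u using (wellFounded_of_isAcyclic h2).induction with
    | _ u ih =>
      by_cases hu : IsSource D u
      · rw [h4 u hu]
      · simp only [IsSource, not_forall, not_not] at hu
        obtain ⟨x, hx⟩ := hu
        exact (((h1.1 x u).2 (Or.inl hx)).symm.reachable).trans (ih x hx)
  have : Nonempty V := ⟨w⟩
  exact ⟨fun u x => (key u).trans (key x).symm⟩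

/-! ### Recursion for the coefficients -/

variable {V : Type*}

/-- `(-1) ^ (|A| - i)` times the coefficient of `x ^ i` in the chromatic polynomial of `G[A]`. -/
noncomputable def signedCoeff (G : SimpleGraph V) (A : Finset V) (i : ℕ) : ℤ :=
  (-1) ^ (A.card + i) * (chi G A).coeff i

theorem signedCoeff_zero [Fintype V] [DecidableEq V] (G : SimpleGraph V) (A : Finset V) :
    signedCoeff G A 0 = if A = ∅ then 1 else 0 := by
  rw [signedCoeff, coeff_zero_eq_eval_zero, chi_eval_zero]
  split_ifs with h <;> simp [h]

theorem signedCoeff_empty_succ (G : SimpleGraph V) (i : ℕ) : signedCoeff G ∅ (i + 1) = 0 := by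
  rw [signedCoeff, chi_empty, coeff_one, if_neg (by omega), mul_zero]

theorem signedCoeff_succ [Fintype V] [DecidableEq V] (G : SimpleGraph V) {A : Finset V} {v : V}
    (hv : v ∈ A) (i : ℕ) : signedCoeff G A (i + 1) =
      ∑ D ∈ A.powerset with v ∈ D, (alphaOn G D v : ℤ) * signedCoeff G (A \ D) i := by
  rw [signedCoeff, chi_eq_X_mul_sum G hv, coeff_X_mul, finsetSum_coeff, Finset.mul_sum]
  refine Finset.sum_congr rfl fun D hD => ?_
  rw [Finset.mem_filter, Finset.mem_powerset] at hD
  rw [coeff_C_mul, chiLinear_eq G hD.2, signedCoeff,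
    ← Finset.card_sdiff_add_card_eq_card hD.1]
  have : ((-1 : ℤ) ^ D.card) * (-1) ^ D.card = 1 := by
    rw [← mul_pow]; simp
  simp only [pow_add, pow_one]
  linear_combination ((-1) ^ (A \ D).card * (-1) ^ i * alphaOn G D v *
    (chi G (A \ D)).coeff i) * this

/-! ### Ordered partitions, split into first part and tail -/

/-- `f` is an ordered partition of `A` into parts that induce connected subgraphs. -/
def IsConnectedPartition (G : SimpleGraph V) (A : Finset V) {i : ℕ} (f : Fin i → Finset V) :
    Prop :=
  (∀ j, (G.induce (f j : Set V)).Connected) ∧ (∀ j k, j ≠ k → Disjoint (f j) (f k)) ∧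
    ∀ u, u ∈ A ↔ ∃ j, u ∈ f j

/-- The least vertex in the union of any part and all later parts is in the former part. -/
def IsOrderedByLeast [LinearOrder V] {i : ℕ} (f : Fin i → Finset V) : Prop :=
  ∀ j, ∃ m ∈ f j, IsLeast {u | ∃ s, j ≤ s ∧ u ∈ f s} m

theorem isConnectedPartition_cons [DecidableEq V] (G : SimpleGraph V) (A D : Finset V) {i : ℕ}
    (g : Fin i → Finset V) :
    IsConnectedPartition G A (Fin.cons D g : Fin (i + 1) → Finset V) ↔
      (G.induce (D : Set V)).Connected ∧ D ⊆ A ∧ IsConnectedPartition G (A \ D) g := by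
  simp only [IsConnectedPartition, Fin.forall_fin_succ, Fin.exists_fin_succ, Fin.cons_zero,
    Fin.cons_succ, Finset.mem_sdiff, ne_eq, not_true_eq_false, false_imp_iff, true_and,
    Fin.succ_inj, (Fin.succ_ne_zero _).symm, Fin.succ_ne_zero, not_false_eq_true, true_imp_iff]
  constructor
  · rintro ⟨⟨h1, h2⟩, ⟨h3, h4⟩, h5⟩
    refine ⟨h1, fun u hu => (h5 u).2 (Or.inl hu), h2, fun j k => (h4 j).2 k, fun u =>
      ⟨fun h => ((h5 u).1 h.1).resolve_left h.2, ?_⟩⟩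
    rintro ⟨j, hj⟩
    exact ⟨(h5 u).2 (Or.inr ⟨j, hj⟩), Finset.disjoint_left.1 (h4 j).1 hj⟩
  · rintro ⟨h1, h2, h3, h4, h5⟩
    have h6 : ∀ j, Disjoint (g j) D := fun j =>
      Finset.disjoint_left.2 fun u hu => ((h5 u).2 ⟨j, hu⟩).2
    refine ⟨⟨h1, h3⟩, ⟨fun j => (h6 j).symm, fun j => ⟨h6 j, h4 j⟩⟩, fun u => ⟨fun h => ?_, ?_⟩⟩
    · by_cases hu : u ∈ D
      · exact Or.inl hu
      · exact Or.inr ((h5 u).1 ⟨h, hu⟩)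
    · rintro (hu | hu)
      · exact h2 hu
      · exact ((h5 u).2 hu).1

theorem isLeast_union_succ_iff [LinearOrder V] {i : ℕ} (f : Fin (i + 1) → Finset V) (j : Fin i)
    (m : V) : IsLeast {u | ∃ s, j.succ ≤ s ∧ u ∈ f s} m ↔
      IsLeast {u | ∃ s, j ≤ s ∧ u ∈ f (Fin.succ s)} m := by
  simp [Fin.exists_fin_succ]

theorem isOrderedByLeast_cons [LinearOrder V] (D : Finset V) {i : ℕ} (g : Fin i → Finset V) :
    IsOrderedByLeast (Fin.cons D g : Fin (i + 1) → Finset V) ↔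
      (∃ m ∈ D, IsLeast {u | u ∈ D ∨ ∃ s, u ∈ g s} m) ∧ IsOrderedByLeast g := by
  rw [IsOrderedByLeast, Fin.forall_fin_succ]
  simp only [isLeast_union_succ_iff, Fin.cons_succ]
  simp only [Fin.cons_zero, Fin.exists_fin_succ, Fin.zero_le, true_and, Fin.cons_succ]
  rfl

/-- The parts have union `A`, so the ordering condition at the first part says that it contains the
least vertex of `A`. -/
theorem isPartition_cons_iff [LinearOrder V] (G : SimpleGraph V) {A : Finset V}
    (hA : A.Nonempty) (D : Finset V) {i : ℕ} (g : Fin i → Finset V) :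
    IsConnectedPartition G A (Fin.cons D g : Fin (i + 1) → Finset V) ∧
        IsOrderedByLeast (Fin.cons D g : Fin (i + 1) → Finset V) ↔
      (G.induce (D : Set V)).Connected ∧ D ⊆ A ∧ A.min' hA ∈ D ∧
        IsConnectedPartition G (A \ D) g ∧ IsOrderedByLeast g := by
  have h : IsConnectedPartition G A (Fin.cons D g : Fin (i + 1) → Finset V) →
      ((∃ m ∈ D, IsLeast {u | u ∈ D ∨ ∃ s, u ∈ g s} m) ↔ A.min' hA ∈ D) := by
    intro h
    have h1 : {u | u ∈ D ∨ ∃ s, u ∈ g s} = (A : Set V) := by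
      ext u
      simpa [Fin.exists_fin_succ] using (h.2.2 u).symm
    rw [h1]
    constructor
    · rintro ⟨m, hm, hl⟩
      rwa [(A.isLeast_min' hA).unique hl]
    · exact fun h => ⟨_, h, A.isLeast_min' hA⟩
  rw [isOrderedByLeast_cons]
  have h2 := isConnectedPartition_cons G A D g
  constructor
  · rintro ⟨h3, h4, h5⟩
    exact ⟨(h2.1 h3).1, (h2.1 h3).2.1, (h h3).1 h4, (h2.1 h3).2.2, h5⟩
  · rintro ⟨h3, h4, h5, h6, h7⟩
    have h8 := h2.2 ⟨h3, h4, h6⟩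
    exact ⟨h8, (h h8).2 h5, h7⟩

/-- The number of acyclic orientations of `G[A]` with the least vertex as the unique source. -/
noncomputable def alphaMin [LinearOrder V] (G : SimpleGraph V) (A : Finset V) : ℕ :=
  -- The default is harmless: parts inducing connected subgraphs are nonempty.
  if h : A.Nonempty then alphaOn G A (A.min' h) else 0

open scoped Classical in
/-- The sum over the ordered partitions of `A` into `i` parts that are ordered by least
vertices. -/
noncomputable def partitionSum [Fintype V] [LinearOrder V] (G : SimpleGraph V) (i : ℕ)
    (A : Finset V) : ℕ :=
  ∑ g : Fin i → Finset V with IsConnectedPartition G A g ∧ IsOrderedByLeast g,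
    ∏ j, alphaMin G (g j)

theorem sum_fin_succ [Fintype V] [DecidableEq V] {i : ℕ}
    (Φ : (Fin (i + 1) → Finset V) → ℕ) :
    ∑ f, Φ f = ∑ D : Finset V, ∑ g : Fin i → Finset V, Φ (Fin.cons D g) := by
  rw [← Fintype.sum_prod_type']
  exact (Fintype.sum_equiv (Fin.consEquiv fun _ => Finset V) _ _ fun _ => rfl).symm

-- Serves both kinds of step, with root `v` or the least vertex. The connectedness condition on `D`
-- drops out because `alphaOn G D v` is zero otherwise.
open scoped Classical in
theorem sum_rooted [Fintype V] [LinearOrder V] (G : SimpleGraph V) (A : Finset V) (v : V)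
    (i : ℕ) : (∑ D : Finset V, ∑ g : Fin i → Finset V,
      if (G.induce (D : Set V)).Connected ∧ D ⊆ A ∧ v ∈ D ∧
        IsConnectedPartition G (A \ D) g ∧ IsOrderedByLeast g
      then alphaOn G D v * ∏ j, alphaMin G (g j) else 0) =
    ∑ D ∈ A.powerset with v ∈ D, alphaOn G D v * partitionSum G i (A \ D) := by
  rw [← Finset.sum_subset (Finset.subset_univ (A.powerset.filter fun D => v ∈ D))]
  · refine Finset.sum_congr rfl fun D hD => ?_
    rw [Finset.mem_filter, Finset.mem_powerset] at hD
    simp only [hD.1, hD.2, true_and]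
    by_cases hc : (G.induce (D : Set V)).Connected
    · simp only [hc, true_and]
      rw [← Finset.sum_filter, partitionSum, Finset.mul_sum]
    · have h0 : alphaOn G D v = 0 := by
        by_contra h
        rw [alphaOn, dif_pos hD.2] at h
        exact hc (connected_of_alpha_ne_zero h)
      simp [hc, h0]
  · intro D _ hD
    rw [Finset.mem_filter, Finset.mem_powerset] at hD
    exact Finset.sum_eq_zero fun g _ => if_neg fun h => hD ⟨h.2.1, h.2.2.1⟩

theorem partitionSum_succ [Fintype V] [LinearOrder V] (G : SimpleGraph V) (i : ℕ)
    {A : Finset V} (hA : A.Nonempty) : partitionSum G (i + 1) A =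
      ∑ D ∈ A.powerset with A.min' hA ∈ D,
        alphaOn G D (A.min' hA) * partitionSum G i (A \ D) := by
  classical
  rw [← sum_rooted, partitionSum, Finset.sum_filter, sum_fin_succ]
  refine Finset.sum_congr rfl fun D _ => Finset.sum_congr rfl fun g _ => ?_
  simp only [isPartition_cons_iff G hA, Fin.prod_univ_succ, Fin.cons_zero, Fin.cons_succ]
  split_ifs with h
  · have hD : D.Nonempty := ⟨_, h.2.2.1⟩
    have : D.min' hD = A.min' hA := le_antisymm (D.min'_le _ h.2.2.1)
      (A.min'_le _ (h.2.1 (D.min'_mem hD)))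
    rw [alphaMin, dif_pos hD, this]
  · rfl

/-- Both sides satisfy the same recursion, rooted at the least vertex of `A`. -/
theorem partitionSum_eq [Fintype V] [LinearOrder V] (G : SimpleGraph V) (i : ℕ)
    (A : Finset V) : (partitionSum G i A : ℤ) = signedCoeff G A i := by
  classical
  induction i generalizing A with
  | zero =>
    rw [signedCoeff_zero]
    have h : ∀ g : Fin 0 → Finset V, IsConnectedPartition G A g ∧ IsOrderedByLeast g ↔ A = ∅ :=
      fun g => by
        simp [IsConnectedPartition, IsOrderedByLeast, Finset.eq_empty_iff_forall_notMem]
    simp only [partitionSum, h]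
    split_ifs with hA <;> simp [hA]
  | succ i ih =>
    rcases A.eq_empty_or_nonempty with rfl | hA
    · rw [signedCoeff_empty_succ, partitionSum, Finset.sum_eq_zero, Nat.cast_zero]
      intro g hg
      obtain ⟨m, hm, -⟩ := (Finset.mem_filter.1 hg).2.2 0
      simpa using ((Finset.mem_filter.1 hg).2.1.2.2 m).2 ⟨0, hm⟩
    · rw [partitionSum_succ G i hA, signedCoeff_succ G (A.min'_mem hA)]
      push_cast
      exact Finset.sum_congr rfl fun D _ => by rw [ih]

theorem alpha_root_eq [LinearOrder V] {G : SimpleGraph V} {i : ℕ} {v : V}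
    (P : OrderedPartition G i v) (hi : 0 < i) :
    alpha (G.induce (P.part ⟨0, hi⟩ : Set V)) (P.root hi) = alphaOn G (P.part ⟨0, hi⟩) v := by
  rw [alphaOn, dif_pos (P.mem_first hi)]
  rfl

theorem alpha_least_eq [LinearOrder V] {G : SimpleGraph V} {i : ℕ} {v : V}
    (P : OrderedPartition G i v) (j : Fin i) :
    alpha (G.induce (P.part j : Set V)) (P.least j) = alphaMin G (P.part j) := by
  rw [alphaMin, dif_pos (P.nonempty j), alphaOn, dif_pos ((P.part j).min'_mem (P.nonempty j))]
  rfl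

-- The ordering condition exempts the first part, so it constrains only the tail `g`; the first part
-- `D` needs to contain `v` instead. The trivial condition `D ⊆ Finset.univ` matches the form of
-- `sum_rooted`.
open scoped Classical in
theorem sum_orderedPartition [Fintype V] [LinearOrder V] (G : SimpleGraph V) (i : ℕ) (v : V)
    (Φ : (Fin (i + 1) → Finset V) → ℕ) :
    ∑ P : OrderedPartition G (i + 1) v, Φ P.part = ∑ D : Finset V, ∑ g : Fin i → Finset V,
      if (G.induce (D : Set V)).Connected ∧ D ⊆ Finset.univ ∧ v ∈ D ∧
        IsConnectedPartition G (Finset.univ \ D) g ∧ IsOrderedByLeast g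
      then Φ (Fin.cons D g) else 0 := by
  have h : ∀ (D : Finset V) (g : Fin i → Finset V),
      ((G.induce (D : Set V)).Connected ∧ D ⊆ Finset.univ ∧ v ∈ D ∧
        IsConnectedPartition G (Finset.univ \ D) g ∧ IsOrderedByLeast g) ↔
      ∃ P : OrderedPartition G (i + 1) v, P.part = Fin.cons D g := by
    intro D g
    have h1 := isConnectedPartition_cons G Finset.univ D g
    constructor
    · rintro ⟨h2, h3, h4, h5, h6⟩
      obtain ⟨h7, h8, h9⟩ := h1.2 ⟨h2, h3, h5⟩
      refine ⟨⟨Fin.cons D g, fun j => ?_, h8, fun u => (h9 u).1 (Finset.mem_univ u), h7,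
        fun _ => h4, fun j hj => ?_⟩, rfl⟩
      · obtain ⟨u⟩ := (h7 j).nonempty
        exact ⟨u.1, u.2⟩
      · obtain ⟨k, rfl⟩ := Fin.exists_succ_eq.2 (Fin.pos_iff_ne_zero.1 hj)
        simp only [isLeast_union_succ_iff, Fin.cons_succ]
        exact h6 k
    · rintro ⟨P, hP⟩
      obtain ⟨h2, h3, h4⟩ := h1.1 ⟨fun j => hP ▸ P.connected j, fun j k => hP ▸ P.disjoint j k,
        fun u => ⟨fun _ => hP ▸ P.cover u, fun _ => Finset.mem_univ u⟩⟩
      refine ⟨h2, h3, ?_, h4, fun j => ?_⟩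
      · have h5 := P.mem_first (Nat.succ_pos i)
        rw [hP] at h5
        exact h5
      · have h5 := P.least_mem j.succ (Nat.succ_pos _)
        simpa only [hP, isLeast_union_succ_iff, Fin.cons_succ] using h5
  simp only [h]
  rw [← sum_fin_succ (fun f : Fin (i + 1) → Finset V =>
    if ∃ P : OrderedPartition G (i + 1) v, P.part = f then Φ f else 0), ← Finset.sum_filter]
  refine Finset.sum_bij (fun P _ => P.part) ?_ ?_ ?_ fun _ _ => rfl
  · exact fun P _ => Finset.mem_filter.2 ⟨Finset.mem_univ _, P, rfl⟩
  · exact fun P _ Q _ h => OrderedPartition.ext h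
  · intro f hf
    obtain ⟨P, hP⟩ := (Finset.mem_filter.1 hf).2
    exact ⟨P, Finset.mem_univ P, hP⟩

/-- The exponents n - i and n + i have the same parity; `hi` keeps the natural subtraction from
truncating. -/
theorem chromaticCoeff_eq_signedCoeff [Fintype V] (G : SimpleGraph V) {i : ℕ}
    (hi : i ≤ Fintype.card V) : chromaticCoeff G i = signedCoeff G Finset.univ i := by
  rw [chromaticCoeff, signedCoeff, chi_univ, Finset.card_univ]
  obtain ⟨k, hk⟩ := Nat.exists_eq_add_of_le hi
  rw [hk, Nat.add_sub_cancel_left, add_right_comm, pow_add, ← two_mul, pow_mul]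
  simp

end ChromaticCoeff

theorem mainTheorem6 {V : Type*} [Fintype V] [LinearOrder V] (G : SimpleGraph V) (v : V)
    (i : ℕ) (hi : 1 ≤ i) (hin : i ≤ Fintype.card V) :
    ChromaticCoeff.chromaticCoeff G i =
      ((∑ P : ChromaticCoeff.OrderedPartition G i v,
          ChromaticCoeff.alpha (G.induce (P.part ⟨0, hi⟩ : Set V)) (P.root hi) *
            ∏ j : Fin i with 0 < j.val,
              ChromaticCoeff.alpha (G.induce (P.part j : Set V)) (P.least j) : ℕ) : ℤ) := by
  classical
  obtain ⟨i, rfl⟩ := Nat.exists_eq_add_of_le' hi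
  simp only [ChromaticCoeff.alpha_root_eq, ChromaticCoeff.alpha_least_eq]
  rw [ChromaticCoeff.sum_orderedPartition G i v fun f =>
    ChromaticCoeff.alphaOn G (f ⟨0, hi⟩) v *
      ∏ j : Fin (i + 1) with 0 < j.val, ChromaticCoeff.alphaMin G (f j)]
  have h : ∀ (D : Finset V) (g : Fin i → Finset V),
      ChromaticCoeff.alphaOn G ((Fin.cons D g : Fin (i + 1) → Finset V) ⟨0, hi⟩) v *
        ∏ j : Fin (i + 1) with 0 < j.val,
          ChromaticCoeff.alphaMin G ((Fin.cons D g : Fin (i + 1) → Finset V) j) =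
      ChromaticCoeff.alphaOn G D v * ∏ j, ChromaticCoeff.alphaMin G (g j) := by
    intro D g
    rw [Finset.prod_filter, Fin.prod_univ_succ]
    simp
  simp only [h]
  rw [ChromaticCoeff.sum_rooted, ChromaticCoeff.chromaticCoeff_eq_signedCoeff G hin,
    ChromaticCoeff.signedCoeff_succ G (Finset.mem_univ v)]
  push_cast
  exact Finset.sum_congr rfl fun D _ => by rw [ChromaticCoeff.partitionSum_eq]
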